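/- Let $\hbar,m_0,Y,\tau>0$, $0<X_0<X$, and let $J,K\ge 1$ be integers. Put $c_\hbar=\frac{\hbar^2}{2m_0}$, $h_x=X/J$, $h_y=Y/K$, $x_j=jh_x$, $y_k=kh_y$, and assume $h_x\le X-X_0$. Let $V(x,y)$ and $\tilde V(x)$ be real potentials with $V(x,y)=\tilde V(x)=V_\infty$ for $x\ge X_0$, $0<y<Y$, where $V_\infty\in\mathbb R$, and let $\Delta V=V-\tilde V$. Meshes: $\overline\omega_{h,\infty}=\{(x_j,y_k): j\ge0,\ 0\le k\le K\}$, $\omega_{h,\infty}=\{(x_j,y_k): j\ge1,\ 1\le k\le K-1\}$, $\Gamma_{h,\infty}=\overline\omega_{h,\infty}\setminus\omega_{h,\infty}$, $\overline\omega_h=\{(x_j,y_k)\in\overline\omega_{h,\infty}: j\le J\}$, $\omega_h=\{(x_j,y_k)\in\omega_{h,\infty}: j\le J-1\}$, $\Gamma_{1h}=\{(x_J,y_k): 1\le k\le K-1\}$, $\Gamma_h=(\overline\omega_h\setminus\omega_h)\setminus\Gamma_{1h}$. Let $H_h$ be the space of $W:\overline\omega_{h,\infty}\to\mathbb C$ with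 $W|_{\Gamma_{h,\infty}}=0$ and $\sum_{j\ge1}\sum_{k=1}^{K-1}|W_{j,k}|^2<\infty$. Operators: $\bar\partial_xW_j=(W_j-W_{j-1})/h_x$, $\partial_xW_j=(W_{j+1}-W_j)/h_x$, $s_{Nx}W_j=\frac1{12}W_{j-1}+\frac56W_j+\frac1{12}W_{j+1}$, and similarly $\bar\partial_y,\partial_y,s_{Ny}$ in $k$ with step $h_y$; $\Delta_{hN}=s_{Ny}\partial_x\bar\partial_x+s_{Nx}\partial_y\bar\partial_y$, $s_N=I+\frac{h_x^2}{12}\partial_x\bar\partial_x+\frac{h_y^2}{12}\partial_y\bar\partial_y$, $s^-_{\theta x}W_j=\theta W_{j-1}+(\frac12-\theta)W_j$. Let $\Psi^0_h$ and $F^m$ ($m\ge1$) be complex mesh functions on $\overline\omega_{h,\infty}$ such that $\Psi_h^0=0$ and $F^m=0$ on $\omega_{h,\infty}\setminus\omega_h$ for all $m\ge1$, and $\Psi^0_h|_{j=J-1}=0$. Consider, for $m\ge1$, $$i\hbar\frac{\breve\Psi^m-\Psi^{m-1}}{\tau/2}=\Delta V\frac{\breve\Psi^m+\Psi^{m-1}}2,\qquad(1)$$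 $$i\hbar s_N\frac{\widetilde\Psi^m-\breve\Psi^m}{\tau}=-c_\hbar\Delta_{hN}\frac{\widetilde\Psi^m+\breve\Psi^m}2+s_N\Bigl(\tilde V\frac{\widetilde\Psi^m+\breve\Psi^m}2\Bigr)+F^m,\qquad(2)$$ $$i\hbar\frac{\Psi^m-\widetilde\Psi^m}{\tau/2}=\Delta V\frac{\Psi^m+\widetilde\Psi^m}2.\qquad(3)$$ Let $(\Psi,\breve\Psi,\widetilde\Psi)$ be a solution of the splitting scheme on the infinite mesh, that is, (1)-(3) hold on $\omega_{h,\infty}$, $\breve\Psi^m=\widetilde\Psi^m=\Psi^m=0$ on $\Gamma_{h,\infty}$ for all $m\ge1$, and $\Psi^0=\Psi^0_h$ on $\overline\omega_{h,\infty}$, such that $\Psi^m\in H_h$ for all $m\ge0$. Then, for all $m\ge1$, it satisfies the splitting scheme on the finite mesh: (1) and (3) hold on $\omega_h\cup\Gamma_{1h}$, (2) holds on $\omega_h$, $\breve\Psi^m=\widetilde\Psi^m=\Psi^m=0$ on $\Gamma_h$, and $\Psi^0=\Psi^0_h$ on $\overline\omega_h$; and it satisfies the discrete transparent boundary condition $$\Bigl.\Bigl[c_{\hbar,q}\bar\partial_x\frac{\widetilde\Psi^{m(q)}+\breve\Psi^{m(q)}}2-h_xs^-_{\theta_qx}\Bigl(i\hbar\frac{\widetilde\Psi^{m(q)}-\breve\Psi^{m(q)}}\tau-V_{\infty,q}\frac{\breve\Psi^{m(q)}+\widetilde\Psi^{m(q)}}2\Bigr)\Bigr]\Bigr|_{j=J}=c_{\hbar,q}\sum_{p=0}^mR_q^p\,\widetilde\Psi_J^{m-p\,(q)}$$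 for all $m\ge1$ and $1\le q\le K-1$, where $\widetilde\Psi^0:=\Psi^0$ and $Z^{(q)}=\frac2K\sum_{k=1}^{K-1}Z_k\sin\frac{\pi qk}K$. Here $$\lambda_q=\Bigl(\frac2{h_y}\sin\frac{\pi qh_y}{2Y}\Bigr)^2,\quad\sigma_q=1-\frac{h_y^2}{12}\lambda_q,\quad c_{\hbar,q}=c_\hbar\Bigl[1+\Bigl(\frac{h_xh_y\lambda_q}{12\sigma_q}\Bigr)^2\Bigr],\quad\theta_q=\frac1{12\sigma_q},\quad V_{\infty,q}=V_\infty+c_\hbar\frac{\lambda_q}{\sigma_q},$$ and the kernel is given by $R_q^0=c_{1q}$, $R_q^1=-c_{1q}\varkappa_q\mu_q$ and $$R_q^m=\frac{2m-3}m\varkappa_q\mu_qR_q^{m-1}-\frac{m-3}m\varkappa_q^2R_q^{m-2}\quad(m\ge2),$$ with $$a_q=\frac{V_{\infty,q}}{2c_{\hbar,q}}+i\frac{\hbar}{\tau c_{\hbar,q}},\quad\alpha_q=2a_q+(1-4\theta_q)h_x^2a_q^2,\quad\beta_q=2\,\mathrm{Re}\,a_q+(1-4\theta_q)h_x^2|a_q|^2,$$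 $$c_{1q}=-\frac{|\alpha_q|^{1/2}}2e^{-i(\arg\alpha_q)/2},\quad\varkappa_q=-e^{i\arg\alpha_q},\quad\mu_q=\frac{\beta_q}{|\alpha_q|},$$ where the argument is taken in $[0,2\pi)$. Moreover, for $1\le q\le K-1$ one has $\theta_q\in(\frac1{12},\frac18)$, $\alpha_q\ne0$, $\arg\alpha_q\in(0,2\pi)$ and $\mu_q\in(-1,1)$. -/

import Mathlib

noncomputable section

/-- The data of the Schrödinger problem in the semi-infinite strip `(0, ∞) × (0, Y)`, together with
the space mesh `x_j = j X / J` (`j ≥ 0`), `y_k = k Y / K` (`0 ≤ k ≤ K`), the uniform time mesh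
`t_m = m τ`, and the standing assumptions on them. -/
structure StripProblem where
  /-- the constant `ħ` -/
  hbar : ℝ
  /-- the mass -/
  m₀ : ℝ
  /-- the potential is constant for `x ≥ X₀` -/
  X₀ : ℝ
  X : ℝ
  Y : ℝ
  /-- the time step -/
  τ : ℝ
  J : ℕ
  K : ℕ
  /-- the potential `V(x, y)` -/
  V : ℝ → ℝ → ℝ
  /-- the auxiliary potential `Ṽ(x)` -/
  Vaux : ℝ → ℝ
  /-- the constant value of the potentials for large `x` -/
  Vinf : ℝ
  hbar_pos : 0 < hbar
  m₀_pos : 0 < m₀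
  X₀_pos : 0 < X₀
  X₀_lt_X : X₀ < X
  Y_pos : 0 < Y
  τ_pos : 0 < τ
  J_pos : 0 < J
  K_pos : 0 < K
  /-- the step in `x` is at most `X - X₀` -/
  step_le : X / J ≤ X - X₀
  V_eq : ∀ x y : ℝ, X₀ ≤ x → 0 < y → y < Y → V x y = Vinf
  Vaux_eq : ∀ x : ℝ, X₀ ≤ x → Vaux x = Vinf

namespace StripProblem

/-! ### Difference operators in one variable -/

/-- Backward difference quotient; used only at `n ≥ 1`. -/
def bdiff (h : ℝ) (W : ℕ → ℂ) (n : ℕ) : ℂ := (W n - W (n - 1)) / h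

/-- Forward difference quotient. -/
def fdiff (h : ℝ) (W : ℕ → ℂ) (n : ℕ) : ℂ := (W (n + 1) - W n) / h

/-- The Numerov average; used only at `n ≥ 1`. -/
def numerov (W : ℕ → ℂ) (n : ℕ) : ℂ :=
  1 / 12 * W (n - 1) + 5 / 6 * W n + 1 / 12 * W (n + 1)

/-- The one-sided average `θ W_{n-1} + (1/2 - θ) W_n`; used only at `n ≥ 1`. -/
def sMinus (θ : ℝ) (W : ℕ → ℂ) (n : ℕ) : ℂ := θ * W (n - 1) + (1 / 2 - θ) * W n

/-- Discrete convolution `(R * Q)^m = ∑_{p=0}^m R^p Q^{m-p}`. -/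
def conv (R Q : ℕ → ℂ) (m : ℕ) : ℂ := ∑ p ∈ Finset.range (m + 1), R p * Q (m - p)

/-- The argument of a complex number taken in `[0, 2π)`. -/
def argTwoPi (z : ℂ) : ℝ := if 0 ≤ z.arg then z.arg else z.arg + 2 * Real.pi

/-! ### Meshes

A mesh function `W` is a function `ℕ → ℕ → ℂ` of `(j, k)`; only its values at `k ≤ K` (for the finite
mesh, at `j ≤ J` and `k ≤ K`) are ever used. -/

variable (P : StripProblem)

def hx : ℝ := P.X / P.J

def hy : ℝ := P.Y / P.K

/-- The infinite mesh. -/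
def meshInf : Set (ℕ × ℕ) := {p | p.2 ≤ P.K}

/-- The internal part of the infinite mesh. -/
def omegaInf : Set (ℕ × ℕ) := {p | 1 ≤ p.1 ∧ 1 ≤ p.2 ∧ p.2 ≤ P.K - 1}

/-- The boundary of the infinite mesh. -/
def gammaInf : Set (ℕ × ℕ) := P.meshInf \ P.omegaInf

/-- The finite mesh. -/
def meshFin : Set (ℕ × ℕ) := {p | p ∈ P.meshInf ∧ p.1 ≤ P.J}

/-- The internal part of the finite mesh. -/
def omegaFin : Set (ℕ × ℕ) := {p | p ∈ P.omegaInf ∧ p.1 ≤ P.J - 1}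

/-- The artificial boundary `{(x_J, y_k) : 1 ≤ k ≤ K - 1}`. -/
def gammaOne : Set (ℕ × ℕ) := {p | p.1 = P.J ∧ 1 ≤ p.2 ∧ p.2 ≤ P.K - 1}

/-- The boundary of the finite mesh without the artificial boundary. -/
def gammaFin : Set (ℕ × ℕ) := (P.meshFin \ P.omegaFin) \ P.gammaOne

/-- Membership in the Hilbert space `H_h` of square summable mesh functions that vanish on the
boundary of the infinite mesh. -/
def MemH (W : ℕ → ℕ → ℂ) : Prop :=
  (∀ p ∈ P.gammaInf, W p.1 p.2 = 0) ∧
    Summable fun j : ℕ => ∑ k ∈ Finset.Icc 1 (P.K - 1), ‖W (j + 1) k‖ ^ 2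

/-! ### Difference operators on mesh functions -/

/-- `∂_x ∂̄_x`. -/
def dxx (W : ℕ → ℕ → ℂ) : ℕ → ℕ → ℂ :=
  fun j k => fdiff P.hx (bdiff P.hx fun i => W i k) j

/-- `∂_y ∂̄_y`. -/
def dyy (W : ℕ → ℕ → ℂ) : ℕ → ℕ → ℂ :=
  fun j k => fdiff P.hy (bdiff P.hy (W j)) k

/-- The Numerov average in `x`. -/
def sNx (W : ℕ → ℕ → ℂ) : ℕ → ℕ → ℂ := fun j k => numerov (fun i => W i k) j

/-- The Numerov average in `y`. -/
def sNy (W : ℕ → ℕ → ℂ) : ℕ → ℕ → ℂ := fun j k => numerov (W j) k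

/-- `Δ_{hN} = s_{Ny} ∂_x ∂̄_x + s_{Nx} ∂_y ∂̄_y`. -/
def lapN (W : ℕ → ℕ → ℂ) : ℕ → ℕ → ℂ := fun j k => sNy (P.dxx W) j k + sNx (P.dyy W) j k

/-- `s_N = I + (h_x² / 12) ∂_x ∂̄_x + (h_y² / 12) ∂_y ∂̄_y`. -/
def sN (W : ℕ → ℕ → ℂ) : ℕ → ℕ → ℂ :=
  fun j k => W j k + P.hx ^ 2 / 12 * P.dxx W j k + P.hy ^ 2 / 12 * P.dyy W j k

/-! ### The splitting schemes -/

/-- `c_ħ = ħ² / (2 m₀)`. -/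
def cHbar : ℝ := P.hbar ^ 2 / (2 * P.m₀)

/-- `Ṽ` at the nodes. -/
def VauxMesh (j : ℕ) : ℝ := P.Vaux (j * P.hx)

/-- `ΔV = V - Ṽ` at the nodes. -/
def deltaV (j k : ℕ) : ℝ := P.V (j * P.hx) (k * P.hy) - P.VauxMesh j

/-- The half step `iħ (U' - U) / (τ / 2) = ΔV (U' + U) / 2` at the node `(j, k)`. -/
def PotentialStep (U U' : ℕ → ℕ → ℂ) (j k : ℕ) : Prop :=
  Complex.I * P.hbar * ((U' j k - U j k) / (P.τ / 2)) = P.deltaV j k * ((U' j k + U j k) / 2)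

/-- The main step
`iħ s_N (U' - U) / τ = -c_ħ Δ_{hN} (U' + U) / 2 + s_N (Ṽ (U' + U) / 2) + F` at the node `(j, k)`. -/
def MainStep (F U U' : ℕ → ℕ → ℂ) (j k : ℕ) : Prop :=
  Complex.I * P.hbar * P.sN (fun i l => (U' i l - U i l) / P.τ) j k =
    -P.cHbar * P.lapN (fun i l => (U' i l + U i l) / 2) j k
      + P.sN (fun i l => P.VauxMesh i * ((U' i l + U i l) / 2)) j k + F j k

/-- `Ψ`, with the auxiliary unknowns `Ψb` (breve) and `Ψt` (tilde), solves the three-step splitting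
scheme on the infinite space mesh with the initial function `Ψ0` and the free term `F`. -/
structure SolvesInf (Ψ0 : ℕ → ℕ → ℂ) (F Ψ Ψb Ψt : ℕ → ℕ → ℕ → ℂ) : Prop where
  step1 : ∀ m ≥ 1, ∀ p ∈ P.omegaInf, P.PotentialStep (Ψ (m - 1)) (Ψb m) p.1 p.2
  step2 : ∀ m ≥ 1, ∀ p ∈ P.omegaInf, P.MainStep (F m) (Ψb m) (Ψt m) p.1 p.2
  step3 : ∀ m ≥ 1, ∀ p ∈ P.omegaInf, P.PotentialStep (Ψt m) (Ψ m) p.1 p.2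
  boundary : ∀ m ≥ 1, ∀ p ∈ P.gammaInf,
    Ψb m p.1 p.2 = 0 ∧ Ψt m p.1 p.2 = 0 ∧ Ψ m p.1 p.2 = 0
  initial : ∀ p ∈ P.meshInf, Ψ 0 p.1 p.2 = Ψ0 p.1 p.2

/-- The three-step splitting scheme on the finite space mesh (without the condition on the artificial
boundary). -/
structure SolvesFin (Ψ0 : ℕ → ℕ → ℂ) (F Ψ Ψb Ψt : ℕ → ℕ → ℕ → ℂ) : Prop where
  step1 : ∀ m ≥ 1, ∀ p ∈ P.omegaFin ∪ P.gammaOne, P.PotentialStep (Ψ (m - 1)) (Ψb m) p.1 p.2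
  step2 : ∀ m ≥ 1, ∀ p ∈ P.omegaFin, P.MainStep (F m) (Ψb m) (Ψt m) p.1 p.2
  step3 : ∀ m ≥ 1, ∀ p ∈ P.omegaFin ∪ P.gammaOne, P.PotentialStep (Ψt m) (Ψ m) p.1 p.2
  boundary : ∀ m ≥ 1, ∀ p ∈ P.gammaFin,
    Ψb m p.1 p.2 = 0 ∧ Ψt m p.1 p.2 = 0 ∧ Ψ m p.1 p.2 = 0
  initial : ∀ p ∈ P.meshFin, Ψ 0 p.1 p.2 = Ψ0 p.1 p.2

/-! ### The discrete transparent boundary condition -/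

/-- The discrete Fourier sine coefficient `(2 / K) ∑_{k=1}^{K-1} Z_k sin (π q k / K)`. -/
def sineCoeff (Z : ℕ → ℂ) (q : ℕ) : ℂ :=
  2 / P.K * ∑ k ∈ Finset.Icc 1 (P.K - 1), Z k * (Real.sin (Real.pi * q * k / P.K) : ℂ)

def lam (q : ℕ) : ℝ := (2 / P.hy * Real.sin (Real.pi * q * P.hy / (2 * P.Y))) ^ 2

def sig (q : ℕ) : ℝ := 1 - P.hy ^ 2 / 12 * P.lam q

/-- `c_{ħ,q}`. -/
def cHbarQ (q : ℕ) : ℝ := P.cHbar * (1 + (P.hx * P.hy * P.lam q / (12 * P.sig q)) ^ 2)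

/-- `θ_q`. -/
def theta (q : ℕ) : ℝ := 1 / (12 * P.sig q)

/-- `V_{∞,q}`. -/
def VinfQ (q : ℕ) : ℝ := P.Vinf + P.cHbar * (P.lam q / P.sig q)

/-- `a_q`. -/
def aQ (q : ℕ) : ℂ :=
  (P.VinfQ q / (2 * P.cHbarQ q) : ℝ) + Complex.I * (P.hbar / (P.τ * P.cHbarQ q) : ℝ)

/-- `α_q`. -/
def alpha (q : ℕ) : ℂ := 2 * P.aQ q + (1 - 4 * P.theta q) * P.hx ^ 2 * P.aQ q ^ 2

/-- `β_q`. -/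
def beta (q : ℕ) : ℝ :=
  2 * (P.aQ q).re + (1 - 4 * P.theta q) * P.hx ^ 2 * ‖P.aQ q‖ ^ 2

/-- `μ_q`. -/
def mu (q : ℕ) : ℝ := P.beta q / ‖P.alpha q‖

/-- `ϰ_q`. -/
def kappa (q : ℕ) : ℂ := -Complex.exp (Complex.I * argTwoPi (P.alpha q))

/-- `c_{1q}`. -/
def c1 (q : ℕ) : ℂ :=
  -((Real.sqrt ‖P.alpha q‖ / 2 : ℝ) : ℂ) * Complex.exp (-Complex.I * argTwoPi (P.alpha q) / 2)

/-- The convolution kernel `R_q`: `R^0 = c_1`, `R^1 = -c_1 ϰ μ` and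
`R^m = ((2m - 3) / m) ϰ μ R^{m-1} - ((m - 3) / m) ϰ² R^{m-2}` for `m ≥ 2` (below `m = n + 2`). -/
def kernel (q : ℕ) : ℕ → ℂ
  | 0 => P.c1 q
  | 1 => -P.c1 q * P.kappa q * P.mu q
  | n + 2 =>
      (2 * ((n + 2 : ℕ) : ℂ) - 3) / ((n + 2 : ℕ) : ℂ) * P.kappa q * P.mu q * kernel q (n + 1)
        - (((n + 2 : ℕ) : ℂ) - 3) / ((n + 2 : ℕ) : ℂ) * P.kappa q ^ 2 * kernel q n

/-- The discrete transparent boundary condition at `j = J` for the `q`-th Fourier coefficients at the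
time level `m ≥ 1`. The convolution also involves the time level `0`, at which the value of `Ψt` is
understood as that of `Ψ`. -/
def TBC (Ψ Ψb Ψt : ℕ → ℕ → ℕ → ℂ) (q m : ℕ) : Prop :=
  P.cHbarQ q *
        bdiff P.hx (fun j => (P.sineCoeff (Ψt m j) q + P.sineCoeff (Ψb m j) q) / 2) P.J
      - P.hx * sMinus (P.theta q)
          (fun j =>
            Complex.I * P.hbar * ((P.sineCoeff (Ψt m j) q - P.sineCoeff (Ψb m j) q) / P.τ)
              - P.VinfQ q * ((P.sineCoeff (Ψb m j) q + P.sineCoeff (Ψt m j) q) / 2)) P.J =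
    P.cHbarQ q *
      conv (P.kernel q)
        (fun n => P.sineCoeff (if n = 0 then Ψ 0 P.J else Ψt n P.J) q) m

end StripProblem

end

/-! For `j ≥ J - 1` the nodes lie in `x ≥ X₀`, so `ΔV = 0` at the interior nodes there and both half
steps are identities: breve is the old time level, tilde the new one. The sine transform in `y`
diagonalizes the main step into a two-level scheme in `x` with constant coefficients. Since the
initial data vanish for `j ≥ J - 1`, the generating functions `U j` in time satisfy `A U_{j+2} + 2 B
U_{j+1} + A U_j = 0`, with `A`, `B` linear in the formal variable.

The characteristic roots are `(-B ± S) / A`, where `S² = B² - A²`; their product is `1`. Square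
summability in `x` leaves only one of them, that is, `(B + S) U_1 + A U_0 = 0`
(`decaying_solution_of_three_term`). The Legendre-type recurrence of the kernel says that `h_x`
times its generating function is such an `S` (`sq_hx_mul_kernel`), and the branch of the root chosen
in `c1` gives it the right sign (`norm_outer_le`). The coefficients of this relation are the
transparent boundary condition. All power series are formal, so no growth bound in time is needed.

The finite scheme is a restriction of the infinite one. -/

/-! ### Formal power series: decaying solutions and the square root of a quadratic -/

-- The second-order operator factors through the two roots. The component `w` along the rejected
-- root cannot decrease in `j`, so decay forces it to vanish. The weak inequality between constant
-- terms suffices, since limits are taken one coefficient at a time.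
open Filter Topology PowerSeries in
theorem PowerSeries.decaying_solution_of_three_term {A B S : PowerSeries ℂ} {U : ℕ → PowerSeries ℂ}
    (hA : constantCoeff A ≠ 0)
    (hle : ‖constantCoeff A‖ ≤ ‖constantCoeff (B + S)‖)
    (hS : S ^ 2 = B ^ 2 - A ^ 2)
    (hU : ∀ j, A * U (j + 2) + 2 * B * U (j + 1) + A * U j = 0)
    (hlim : ∀ m, Tendsto (fun j => coeff m (U j)) atTop (𝓝 0)) :
    (B + S) * U 1 + A * U 0 = 0 := by
  set w : ℕ → PowerSeries ℂ := fun j => A * U (j + 1) + (B - S) * U j with hw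
  have hrec : ∀ j, A * w (j + 1) = -(B + S) * w j := by
    intro j
    simp only [hw]
    linear_combination A * hU j - U j * hS
  have hmul : ∀ (G : PowerSeries ℂ) (V : ℕ → PowerSeries ℂ),
      (∀ m, Tendsto (fun j => coeff m (V j)) atTop (𝓝 0)) →
      ∀ m, Tendsto (fun j => coeff m (G * V j)) atTop (𝓝 0) := by
    intro G V hV m
    simp only [coeff_mul]
    rw [show (0 : ℂ) = ∑ p ∈ Finset.HasAntidiagonal.antidiagonal m, coeff p.1 G * 0 by simp]
    exact tendsto_finsetSum _ fun p _ => (hV p.2).const_mul _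
  have hwlim : ∀ m, Tendsto (fun j => coeff m (w j)) atTop (𝓝 0) := by
    intro m
    have h1 := (hmul A (fun j => U (j + 1))
      (fun m => (hlim m).comp (tendsto_add_atTop_nat 1)) m).add
      (hmul (B - S) U hlim m)
    simpa [hw] using h1
  have hlow : ∀ (G V : PowerSeries ℂ) (m : ℕ), (∀ n < m, coeff n V = 0) →
      coeff m (G * V) = constantCoeff G * coeff m V := by
    intro G V m hV
    rw [coeff_mul, Finset.sum_eq_single (0, m)]
    · simp
    · rintro ⟨a, b⟩ hab hne
      have hab' := Finset.HasAntidiagonal.mem_antidiagonal.1 hab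
      simp only at hab'
      have : b < m := by
        rcases Nat.eq_zero_or_pos a with rfl | ha
        · exact absurd (by simp at hab'; simp [hab']) hne
        · omega
      simp [hV b this]
    · intro h
      exact absurd (Finset.HasAntidiagonal.mem_antidiagonal.2 (by simp)) h
  -- Once the coefficients below `m` vanish, only constant terms act on the `m`-th one: its norm is
  -- nondecreasing in `j` and tends to `0`.
  have hw0 : ∀ m j, coeff m (w j) = 0 := by
    intro m
    induction m using Nat.strong_induction_on with
    | _ m ih =>
      have hmono : Monotone fun j => ‖coeff m (w j)‖ := by
        refine monotone_nat_of_le_succ fun j => ?_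
        have h1 := congrArg (fun G => ‖coeff m G‖) (hrec j)
        simp only [hlow A (w (j + 1)) m fun n hn => ih n hn _, neg_mul, map_neg, norm_neg,
          hlow (B + S) (w j) m fun n hn => ih n hn _, norm_mul] at h1
        have hpos : 0 < ‖constantCoeff A‖ := norm_pos_iff.2 hA
        have h2 : ‖constantCoeff A‖ * ‖coeff m (w j)‖ ≤
            ‖constantCoeff A‖ * ‖coeff m (w (j + 1))‖ := by
          rw [h1]
          gcongr
        exact le_of_mul_le_mul_left h2 hpos
      intro j
      have := hmono.ge_of_tendsto (by simpa using (hwlim m).norm) j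
      simpa using this
  have hz : w 0 = 0 := PowerSeries.ext fun m => by simpa using hw0 m 0
  have hA' : A ≠ 0 := fun h => hA (by simp [h])
  apply mul_left_cancel₀ hA'
  simp only [hw, zero_add] at hz
  linear_combination (B + S) * hz + U 0 * hS

-- The recurrence is the coefficient form of `2 f' D = f D'`, with `D` the quadratic on the right;
-- this makes `f² / D` constant.
open PowerSeries in
theorem PowerSeries.sq_eq_quadratic_of_recurrence {b d : ℂ} {f : ℕ → ℂ} (h1 : f 1 = -f 0 * b)
    (h2 : ∀ n : ℕ, ((n : ℂ) + 2) * f (n + 2) = (2 * n + 1) * b * f (n + 1) - (n - 1) * d * f n) :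
    (mk f) ^ 2 = C (f 0 ^ 2) * (1 - C (2 * b) * X + C d * X ^ 2) := by
  set D : PowerSeries ℂ := 1 - C (2 * b) * X + C d * X ^ 2 with hD
  have hdD : d⁄dX ℂ D = - C (2 * b) + C (2 * d) * X := by
    have h : d⁄dX ℂ D = - (C (2 * b)) + C d * (2 * X) := by
      simp [hD, Derivation.leibniz, Derivation.leibniz_pow]
    rw [h, map_mul C 2 d, map_ofNat]
    ring
  have hode : 2 * (d⁄dX ℂ (mk f)) * D = mk f * d⁄dX ℂ D := by
    have hl : 2 * (d⁄dX ℂ (mk f)) * D = C 2 * d⁄dX ℂ (mk f) - C (4 * b) * (X * d⁄dX ℂ (mk f))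
        + C (2 * d) * (X * (X * d⁄dX ℂ (mk f))) := by
      simp only [hD, map_mul, map_ofNat]
      ring
    have hr : mk f * d⁄dX ℂ D = - (C (2 * b) * mk f) + C (2 * d) * (X * mk f) := by
      rw [hdD]
      ring
    rw [hl, hr]
    ext n
    -- Degree `0` is `h1` and degree `n + 1` is `h2 n`; degree `1` is separate because the term with
    -- `X * X` has no contribution there.
    rcases n with _ | _ | n
    · simp only [map_add, map_sub, map_neg, coeff_C_mul, coeff_zero_X_mul, coeff_derivative,
        coeff_mk]
      push_cast
      linear_combination 2 * h1
    · have := h2 0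
      simp only [map_add, map_sub, map_neg, coeff_C_mul, coeff_succ_X_mul, coeff_zero_X_mul,
        coeff_derivative, coeff_mk]
      push_cast at this ⊢
      linear_combination 2 * this
    · have := h2 (n + 1)
      simp only [map_add, map_sub, map_neg, coeff_C_mul, coeff_succ_X_mul, coeff_derivative,
        coeff_mk]
      push_cast at this ⊢
      linear_combination 2 * this
  have hD0 : constantCoeff D ≠ 0 := by simp [hD]
  have hinv : D * D⁻¹ = 1 := PowerSeries.mul_inv_cancel _ hD0
  have key : (mk f) ^ 2 * D⁻¹ = C (f 0 ^ 2) := by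
    apply derivative.ext
    · rw [Derivation.leibniz, derivative_inv', Derivation.leibniz_pow, derivative_C]
      simp only [smul_eq_mul, nsmul_eq_mul]
      push_cast
      linear_combination (mk f) * D⁻¹ ^ 2 * hode - 2 * mk f * d⁄dX ℂ (mk f) * D⁻¹ * hinv
    · have hf : constantCoeff (mk f) = f 0 := by
        rw [← coeff_zero_eq_constantCoeff_apply, coeff_mk]
      simp [hD, hf]
  rw [← key, mul_assoc, PowerSeries.inv_mul_cancel _ hD0, mul_one]

/-! ### Square roots in the upper half-plane -/

/-- The argument of `p` is the mean of those of `a` and `b`, all in `(0, π)`, so `p` makes an acute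
angle with `a`. -/
theorem Complex.re_mul_conj_pos_of_sq_eq_mul {a b p : ℂ} (ha : 0 < a.im) (hb : 0 < b.im)
    (hp : 0 < p.im) (h : p ^ 2 = a * b) : 0 < (p * (starRingEnd ℂ) a).re := by
  -- Imaginary part of `p² ā = |a|² b`.
  have hid : b.im * normSq a = 2 * p.im * (p * (starRingEnd ℂ) a).re - normSq p * a.im := by
    have h1 := congrArg (fun z => (z * (starRingEnd ℂ) a).im) h
    simp only [pow_two, mul_re, mul_im, conj_re, conj_im, normSq_apply] at h1 ⊢
    linear_combination -h1
  have ha0 : 0 < normSq a := normSq_pos.2 fun h => by simp [h] at ha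
  have := mul_pos hb ha0
  have := mul_nonneg (normSq_nonneg p) ha.le
  by_contra! hneg
  nlinarith

theorem Complex.exp_half_arg_sq {α : ℂ} (φ : ℝ) (hφ : α = ‖α‖ * Complex.exp (I * φ)) :
    ((Real.sqrt ‖α‖ : ℂ) * Complex.exp (I * φ / 2)) ^ 2 = α := by
  rw [mul_pow, ← Complex.ofReal_pow, Real.sq_sqrt (norm_nonneg _), ← Complex.exp_nat_mul]
  conv_rhs => rw [hφ]
  congr 2
  push_cast
  ring

/-! ### Bounds on the parameters of the Fourier modes -/

namespace StripProblem

theorem norm_mul_exp_argTwoPi (z : ℂ) : z = ‖z‖ * Complex.exp (Complex.I * argTwoPi z) := by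
  have h : Complex.exp (Complex.I * argTwoPi z) = Complex.exp (z.arg * Complex.I) := by
    unfold argTwoPi
    split_ifs
    · rw [mul_comm]
    · push_cast
      rw [mul_add, show Complex.I * (2 * Real.pi) = 2 * Real.pi * Complex.I by ring,
        Complex.exp_periodic, mul_comm]
  rw [h, Complex.norm_mul_exp_arg_mul_I]

theorem argTwoPi_mem_Ioo {z : ℂ} (hz : z.arg ≠ 0) : argTwoPi z ∈ Set.Ioo 0 (2 * Real.pi) := by
  have h1 := Complex.neg_pi_lt_arg z
  have h2 := Complex.arg_le_pi z
  have h3 := Real.pi_pos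
  unfold argTwoPi
  split_ifs with h
  · exact ⟨lt_of_le_of_ne h hz.symm, by linarith⟩
  · exact ⟨by linarith, by linarith⟩

variable (P : StripProblem)

theorem hx_pos : 0 < P.hx :=
  div_pos (P.X₀_pos.trans P.X₀_lt_X) (Nat.cast_pos.2 P.J_pos)

theorem hy_pos : 0 < P.hy := div_pos P.Y_pos (Nat.cast_pos.2 P.K_pos)

theorem cHbar_pos : 0 < P.cHbar := div_pos (pow_pos P.hbar_pos 2) (by linarith [P.m₀_pos])

theorem hy_sq_mul_lam (q : ℕ) :
    P.hy ^ 2 * P.lam q = 4 * Real.sin (Real.pi * q / (2 * P.K)) ^ 2 := by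
  have hK : (P.K : ℝ) ≠ 0 := Nat.cast_ne_zero.2 P.K_pos.ne'
  have hY := P.Y_pos.ne'
  have harg : Real.pi * q * P.hy / (2 * P.Y) = Real.pi * q / (2 * P.K) := by
    unfold hy
    field_simp
  have h := P.hy_pos.ne'
  rw [lam, harg]
  field_simp
  ring

theorem hy_sq_mul_lam_eq_cos (q : ℕ) :
    P.hy ^ 2 * P.lam q = 2 - 2 * Real.cos (Real.pi * q / P.K) := by
  have hK : (P.K : ℝ) ≠ 0 := Nat.cast_ne_zero.2 P.K_pos.ne'
  rw [hy_sq_mul_lam, show Real.pi * q / P.K = 2 * (Real.pi * q / (2 * P.K)) by field_simp,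
    Real.cos_two_mul]
  linear_combination 4 * Real.sin_sq_add_cos_sq (Real.pi * q / (2 * P.K))

variable {q : ℕ}

theorem sig_mem_Ioo (hq : 1 ≤ q) (hqK : q ≤ P.K - 1) : P.sig q ∈ Set.Ioo (2 / 3 : ℝ) 1 := by
  have hK : (0 : ℝ) < P.K := Nat.cast_pos.2 P.K_pos
  have hq0 : (0 : ℝ) < q := by exact_mod_cast hq
  have hqK' : (q : ℝ) < P.K := by
    have := P.K_pos
    exact_mod_cast (by omega : q < P.K)
  set t := Real.pi * q / (2 * P.K) with ht
  have ht0 : 0 < t := by have := Real.pi_pos; positivity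
  have ht1 : t < Real.pi / 2 := by
    rw [ht, div_lt_div_iff₀ (by positivity) two_pos]
    nlinarith [Real.pi_pos]
  have hsig : P.sig q = 1 - Real.sin t ^ 2 / 3 := by
    unfold sig
    linear_combination -(1 / 12) * P.hy_sq_mul_lam q
  have hs : 0 < Real.sin t := Real.sin_pos_of_pos_of_lt_pi ht0 (by linarith)
  have hc : 0 < Real.cos t := Real.cos_pos_of_mem_Ioo ⟨by linarith, ht1⟩
  have := Real.sin_sq_add_cos_sq t
  rw [hsig]
  constructor <;> nlinarith

theorem theta_mem_Ioo (hq : 1 ≤ q) (hqK : q ≤ P.K - 1) :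
    P.theta q ∈ Set.Ioo (1 / 12 : ℝ) (1 / 8) := by
  obtain ⟨h1, h2⟩ := P.sig_mem_Ioo hq hqK
  unfold theta
  constructor
  · rw [div_lt_div_iff₀ (by norm_num) (by linarith)]
    linarith
  · rw [div_lt_div_iff₀ (by linarith) (by norm_num)]
    linarith

theorem cHbarQ_pos (q : ℕ) : 0 < P.cHbarQ q := mul_pos P.cHbar_pos (by positivity)

theorem aQ_im_pos (q : ℕ) : 0 < (P.aQ q).im := by
  have : (P.aQ q).im = P.hbar / (P.τ * P.cHbarQ q) := by
    simp [aQ, -Complex.ofReal_div, -Complex.ofReal_mul]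
  rw [this]
  exact div_pos P.hbar_pos (mul_pos P.τ_pos (P.cHbarQ_pos q))

theorem cHbarQ_mul_aQ (q : ℕ) :
    P.cHbarQ q * P.aQ q = P.VinfQ q / 2 + Complex.I * P.hbar / P.τ := by
  have hc : (P.cHbarQ q : ℂ) ≠ 0 := Complex.ofReal_ne_zero.2 (P.cHbarQ_pos q).ne'
  have hτ : (P.τ : ℂ) ≠ 0 := Complex.ofReal_ne_zero.2 P.τ_pos.ne'
  unfold aQ
  push_cast
  field_simp

theorem cHbarQ_mul_conj_aQ (q : ℕ) :
    P.cHbarQ q * (starRingEnd ℂ) (P.aQ q) = P.VinfQ q / 2 - Complex.I * P.hbar / P.τ := by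
  have h := congrArg (starRingEnd ℂ) (P.cHbarQ_mul_aQ q)
  simp only [map_mul, map_add, map_div₀, Complex.conj_ofReal, Complex.conj_I, map_ofNat] at h
  rw [h]
  ring

/-- `δ_q = (1 - 4θ_q) h_x²`. -/
noncomputable def delta (q : ℕ) : ℝ := (1 - 4 * P.theta q) * P.hx ^ 2

theorem delta_pos (hq : 1 ≤ q) (hqK : q ≤ P.K - 1) : 0 < P.delta q :=
  mul_pos (by linarith [(P.theta_mem_Ioo hq hqK).2]) (pow_pos P.hx_pos 2)

theorem alpha_eq_mul (q : ℕ) : P.alpha q = P.aQ q * (2 + P.delta q * P.aQ q) := by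
  unfold alpha delta
  push_cast
  ring

theorem im_two_add_delta_mul_aQ_pos (hq : 1 ≤ q) (hqK : q ≤ P.K - 1) :
    0 < (2 + P.delta q * P.aQ q).im := by
  simpa using mul_pos (P.delta_pos hq hqK) (P.aQ_im_pos q)

theorem alpha_ne_zero (hq : 1 ≤ q) (hqK : q ≤ P.K - 1) : P.alpha q ≠ 0 := by
  have h1 := P.aQ_im_pos q
  have h2 := P.im_two_add_delta_mul_aQ_pos hq hqK
  rw [alpha_eq_mul]
  refine mul_ne_zero (fun h => ?_) fun h => ?_
  · simp [h] at h1
  · simp [h] at h2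

theorem arg_alpha_ne_zero (hq : 1 ≤ q) (hqK : q ≤ P.K - 1) : (P.alpha q).arg ≠ 0 := by
  have h1 := P.aQ_im_pos q
  have h2 := P.delta_pos hq hqK
  rw [Ne, Complex.arg_eq_zero_iff]
  rintro ⟨hre, him⟩
  simp only [alpha_eq_mul, Complex.mul_re, Complex.mul_im, Complex.add_re, Complex.add_im,
    Complex.re_ofNat, Complex.im_ofNat, Complex.ofReal_re, Complex.ofReal_im] at hre him
  -- If `α` were real, then `δ Re a = -1`, and so `Re α = -δ |a|² < 0`.
  have him' : 1 + P.delta q * (P.aQ q).re = 0 := by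
    apply mul_left_cancel₀ h1.ne'
    linear_combination him / 2
  nlinarith [mul_pos h2 (mul_pos h1 h1), mul_nonneg h2.le (sq_nonneg (P.aQ q).re)]

theorem beta_eq_re (q : ℕ) :
    P.beta q = ((starRingEnd ℂ) (P.aQ q) * (2 + P.delta q * P.aQ q)).re := by
  simp only [beta, delta, Complex.sq_norm, Complex.normSq_apply, Complex.mul_re, Complex.add_re,
    Complex.add_im, Complex.conj_re, Complex.conj_im, Complex.mul_im, Complex.ofReal_re,
    Complex.ofReal_im, Complex.re_ofNat, Complex.im_ofNat]
  ring

theorem mu_mem_Ioo (hq : 1 ≤ q) (hqK : q ≤ P.K - 1) : P.mu q ∈ Set.Ioo (-1 : ℝ) 1 := by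
  have hα := norm_pos_iff.2 (P.alpha_ne_zero hq hqK)
  have h1 := P.aQ_im_pos q
  -- `β` is the real part of `ā (2 + δ a)`, which has the modulus of `α` and the nonzero imaginary
  -- part `-2 Im a`.
  have hlt : |P.beta q| < ‖P.alpha q‖ := by
    rw [beta_eq_re, alpha_eq_mul, norm_mul, ← Complex.norm_conj (P.aQ q), ← norm_mul,
      Complex.abs_re_lt_norm]
    simp only [Complex.mul_im, Complex.add_re,
      Complex.add_im, Complex.conj_re, Complex.conj_im, Complex.mul_re, Complex.ofReal_re,
      Complex.ofReal_im, Complex.re_ofNat, Complex.im_ofNat]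
    intro h
    apply h1.ne'
    linear_combination -h / 2
  rw [abs_lt] at hlt
  unfold mu
  exact ⟨by rw [lt_div_iff₀ hα]; linarith, by rw [div_lt_iff₀ hα]; linarith⟩

/-! ### The kernel -/

theorem conj_alpha_eq (q : ℕ) : (starRingEnd ℂ) (P.alpha q) =
    ‖P.alpha q‖ * Complex.exp (-Complex.I * argTwoPi (P.alpha q)) := by
  conv_lhs => rw [norm_mul_exp_argTwoPi (P.alpha q)]
  rw [map_mul, Complex.conj_ofReal, ← Complex.exp_conj, map_mul, Complex.conj_I,
    Complex.conj_ofReal]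

theorem c1_sq (q : ℕ) : P.c1 q ^ 2 = (starRingEnd ℂ) (P.alpha q) / 4 := by
  rw [conj_alpha_eq, c1, mul_pow, ← Complex.exp_nat_mul]
  have h : ((Real.sqrt ‖P.alpha q‖ : ℝ) : ℂ) ^ 2 = (‖P.alpha q‖ : ℝ) := by
    rw [← Complex.ofReal_pow, Real.sq_sqrt (norm_nonneg _)]
  rw [show ((2 : ℕ) : ℂ) * (-Complex.I * argTwoPi (P.alpha q) / 2) =
    -Complex.I * argTwoPi (P.alpha q) by push_cast; ring]
  push_cast
  linear_combination (1 / 4) * Complex.exp (-Complex.I * argTwoPi (P.alpha q)) * h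

theorem c1_sq_mul_kappa_mul_mu (hq : 1 ≤ q) (hqK : q ≤ P.K - 1) :
    P.c1 q ^ 2 * (P.kappa q * P.mu q) = -P.beta q / 4 := by
  have hα : (‖P.alpha q‖ : ℂ) ≠ 0 :=
    Complex.ofReal_ne_zero.2 (norm_ne_zero_iff.2 (P.alpha_ne_zero hq hqK))
  rw [c1_sq, conj_alpha_eq, kappa, mu, neg_mul Complex.I, Complex.exp_neg]
  have he := Complex.exp_ne_zero (Complex.I * argTwoPi (P.alpha q))
  push_cast
  field_simp

theorem c1_sq_mul_kappa_sq (q : ℕ) : P.c1 q ^ 2 * P.kappa q ^ 2 = P.alpha q / 4 := by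
  rw [c1_sq, conj_alpha_eq]
  conv_rhs => rw [norm_mul_exp_argTwoPi (P.alpha q)]
  rw [kappa, neg_mul Complex.I, Complex.exp_neg]
  have he := Complex.exp_ne_zero (Complex.I * argTwoPi (P.alpha q))
  field_simp

/-- Comparison of the two characteristic roots: the choice of the branch of the square root in
`c_{1q}` selects the decaying solution. -/
theorem re_mul_conj_c1_nonneg (hq : 1 ≤ q) (hqK : q ≤ P.K - 1) {t : ℝ}
    (ht : P.delta q / 2 ≤ t) :
    0 ≤ (-(1 + t * (starRingEnd ℂ) (P.aQ q)) * (starRingEnd ℂ) (P.c1 q)).re := by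
  have hα := norm_pos_iff.2 (P.alpha_ne_zero hq hqK)
  obtain ⟨hφ0, hφ1⟩ := argTwoPi_mem_Ioo (P.arg_alpha_ne_zero hq hqK)
  set φ := argTwoPi (P.alpha q) with hφ
  set p : ℂ := (Real.sqrt ‖P.alpha q‖ : ℂ) * Complex.exp (Complex.I * φ / 2) with hp
  have hp2 : p ^ 2 = P.alpha q := Complex.exp_half_arg_sq φ (norm_mul_exp_argTwoPi _)
  have hpim : 0 < p.im := by
    have : p.im = Real.sqrt ‖P.alpha q‖ * Real.sin (φ / 2) := by
      rw [hp, Complex.im_ofReal_mul, show Complex.I * φ / 2 = ((φ / 2 : ℝ) : ℂ) * Complex.I by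
        push_cast; ring, Complex.exp_ofReal_mul_I_im]
    rw [this]
    exact mul_pos (Real.sqrt_pos.2 hα)
      (Real.sin_pos_of_pos_of_lt_pi (by linarith) (by linarith))
  have hc : (starRingEnd ℂ) (P.c1 q) = -p / 2 := by
    rw [c1, ← hφ, hp, map_mul, map_neg, Complex.conj_ofReal, ← Complex.exp_conj, map_div₀, map_mul,
      map_neg, Complex.conj_I, Complex.conj_ofReal, map_ofNat]
    push_cast
    ring_nf
  have h1 := Complex.re_mul_conj_pos_of_sq_eq_mul (P.aQ_im_pos q)
    (P.im_two_add_delta_mul_aQ_pos hq hqK) hpim (hp2.trans (P.alpha_eq_mul q))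
  have h2 := Complex.re_mul_conj_pos_of_sq_eq_mul (P.im_two_add_delta_mul_aQ_pos hq hqK)
    (P.aQ_im_pos q) hpim ((hp2.trans (P.alpha_eq_mul q)).trans (mul_comm _ _))
  -- With `conj c1 = -p / 2`, the factor `1 + t ā` is a nonnegative combination of the conjugates of
  -- `2 + δ a` and `a`, the two factors of `α = p²`; both make an acute angle with `p`.
  have hsplit : -(1 + t * (starRingEnd ℂ) (P.aQ q)) * (starRingEnd ℂ) (P.c1 q) =
      ((1 / 4 : ℝ) : ℂ) * (p * (starRingEnd ℂ) (2 + P.delta q * P.aQ q)) +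
        (((t - P.delta q / 2) / 2 : ℝ) : ℂ) * (p * (starRingEnd ℂ) (P.aQ q)) := by
    rw [hc]
    simp only [map_add, map_mul, map_ofNat, Complex.conj_ofReal]
    push_cast
    ring
  rw [hsplit, Complex.add_re, Complex.re_ofReal_mul, Complex.re_ofReal_mul]
  have := mul_nonneg (by linarith : 0 ≤ (t - P.delta q / 2) / 2) h1.le
  linarith

end StripProblem

/-! ### Sine transform in `y` and reduction to constant coefficients -/

namespace StripProblem

variable (P : StripProblem)

theorem sineCoeff_congr {Z Z' : ℕ → ℂ} (q : ℕ)
    (h : ∀ k, 1 ≤ k → k ≤ P.K - 1 → Z k = Z' k) : P.sineCoeff Z q = P.sineCoeff Z' q := by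
  unfold sineCoeff
  congr 1
  refine Finset.sum_congr rfl fun k hk => ?_
  rw [Finset.mem_Icc] at hk
  rw [h k hk.1 hk.2]

theorem sineCoeff_add (Z Z' : ℕ → ℂ) (q : ℕ) :
    P.sineCoeff (fun k => Z k + Z' k) q = P.sineCoeff Z q + P.sineCoeff Z' q := by
  simp only [sineCoeff, add_mul, Finset.sum_add_distrib, mul_add]

theorem sineCoeff_const_mul (c : ℂ) (Z : ℕ → ℂ) (q : ℕ) :
    P.sineCoeff (fun k => c * Z k) q = c * P.sineCoeff Z q := by
  simp only [sineCoeff, mul_assoc, ← Finset.mul_sum]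
  ring

theorem sineCoeff_sub (Z Z' : ℕ → ℂ) (q : ℕ) :
    P.sineCoeff (fun k => Z k - Z' k) q = P.sineCoeff Z q - P.sineCoeff Z' q := by
  simp only [sineCoeff, sub_mul, Finset.sum_sub_distrib, mul_sub]

theorem sineCoeff_div_const (c : ℂ) (Z : ℕ → ℂ) (q : ℕ) :
    P.sineCoeff (fun k => Z k / c) q = P.sineCoeff Z q / c := by
  simp only [div_eq_inv_mul _ c, sineCoeff_const_mul]

/-- Summation by parts for second differences. -/
theorem sum_second_diff_mul (W s : ℕ → ℂ) (N : ℕ) (hW0 : W 0 = 0) (hs0 : s 0 = 0)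
    (hWN : W (N + 1) = 0) (hsN : s (N + 1) = 0) :
    ∑ k ∈ Finset.Icc 1 N, (W (k - 1) + W (k + 1)) * s k =
      ∑ k ∈ Finset.Icc 1 N, W k * (s (k - 1) + s (k + 1)) := by
  have hreindex : ∀ f : ℕ → ℂ, ∑ k ∈ Finset.Icc 1 N, f k = ∑ i ∈ Finset.range N, f (i + 1) := by
    intro f
    rw [Finset.range_eq_Ico, Finset.sum_Ico_add' f 0 N 1]
    rfl
  rw [hreindex, hreindex, ← sub_eq_zero, ← Finset.sum_sub_distrib]
  -- The difference of the two sums telescopes: it is a discrete Wronskian, zero at both ends.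
  have h := Finset.sum_range_sub (fun i => W (i + 1) * s i - W i * s (i + 1)) N
  simp only [hs0, hWN, hW0, hsN, mul_zero, zero_mul, sub_zero] at h
  rw [← h]
  refine Finset.sum_congr rfl fun i _ => ?_
  rw [Nat.add_sub_cancel]
  ring

/-- The shifts are moved onto the sine, an eigenvector with eigenvalue `2 cos (π q / K)`. -/
theorem sineCoeff_second_diff {W : ℕ → ℂ} (hW0 : W 0 = 0) (hWK : W P.K = 0) (q : ℕ) :
    P.sineCoeff (fun k => W (k - 1) + W (k + 1)) q =
      (2 - P.hy ^ 2 * P.lam q : ℝ) * P.sineCoeff W q := by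
  have hK : (P.K : ℝ) ≠ 0 := Nat.cast_ne_zero.2 P.K_pos.ne'
  have hK1 : P.K - 1 + 1 = P.K := Nat.succ_pred_eq_of_pos P.K_pos
  have h := sum_second_diff_mul W (fun k => (Real.sin (Real.pi * q * k / P.K) : ℂ)) (P.K - 1)
    hW0 (by simp) (by rw [hK1, hWK]) (by
      rw [hK1, mul_div_assoc, div_self hK, mul_one, mul_comm, Real.sin_nat_mul_pi,
        Complex.ofReal_zero])
  have hsum : ∀ k ∈ Finset.Icc 1 (P.K - 1),
      W k * ((Real.sin (Real.pi * q * (k - 1 : ℕ) / P.K) : ℂ) +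
        (Real.sin (Real.pi * q * (k + 1 : ℕ) / P.K) : ℂ)) =
      (2 - P.hy ^ 2 * P.lam q : ℝ) * (W k * (Real.sin (Real.pi * q * k / P.K) : ℂ)) := by
    intro k hk
    have h1 := (Finset.mem_Icc.1 hk).1
    have hsin : Real.sin (Real.pi * q * (k - 1 : ℕ) / P.K) +
        Real.sin (Real.pi * q * (k + 1 : ℕ) / P.K) =
        (2 - P.hy ^ 2 * P.lam q) * Real.sin (Real.pi * q * k / P.K) := by
      rw [hy_sq_mul_lam_eq_cos, Nat.cast_sub h1, Nat.cast_add, Nat.cast_one,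
        show Real.pi * q * ((k : ℝ) - 1) / P.K = Real.pi * q * k / P.K - Real.pi * q / P.K by ring,
        show Real.pi * q * ((k : ℝ) + 1) / P.K = Real.pi * q * k / P.K + Real.pi * q / P.K by ring,
        Real.sin_add, Real.sin_sub]
      ring
    rw [← Complex.ofReal_add, hsin]
    push_cast
    ring
  unfold sineCoeff
  rw [h, Finset.sum_congr rfl hsum, ← Finset.mul_sum]
  ring

theorem dyy_apply (W : ℕ → ℕ → ℂ) (j k : ℕ) :
    P.dyy W j k = (W j (k - 1) + W j (k + 1) - 2 * W j k) / P.hy ^ 2 := by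
  have h : (P.hy : ℂ) ≠ 0 := Complex.ofReal_ne_zero.2 P.hy_pos.ne'
  simp only [dyy, fdiff, bdiff, Nat.add_sub_cancel]
  field_simp
  ring

theorem dxx_apply (W : ℕ → ℕ → ℂ) (j k : ℕ) :
    P.dxx W j k = (W (j - 1) k + W (j + 1) k - 2 * W j k) / P.hx ^ 2 := by
  have h : (P.hx : ℂ) ≠ 0 := Complex.ofReal_ne_zero.2 P.hx_pos.ne'
  simp only [dxx, fdiff, bdiff, Nat.add_sub_cancel]
  field_simp
  ring

theorem sineCoeff_dyy {W : ℕ → ℕ → ℂ} {j : ℕ} (hW0 : W j 0 = 0) (hWK : W j P.K = 0) (q : ℕ) :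
    P.sineCoeff (P.dyy W j) q = -P.lam q * P.sineCoeff (W j) q := by
  have h : (P.hy : ℂ) ≠ 0 := Complex.ofReal_ne_zero.2 P.hy_pos.ne'
  have he : P.dyy W j = fun k => (W j (k - 1) + W j (k + 1) - 2 * W j k) / P.hy ^ 2 :=
    funext fun k => P.dyy_apply W j k
  rw [he, sineCoeff_div_const, sineCoeff_sub, P.sineCoeff_second_diff hW0 hWK, sineCoeff_const_mul]
  push_cast
  field_simp
  ring

theorem sineCoeff_dxx (W : ℕ → ℕ → ℂ) (j q : ℕ) :
    P.sineCoeff (P.dxx W j) q = (P.sineCoeff (W (j - 1)) q + P.sineCoeff (W (j + 1)) q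
      - 2 * P.sineCoeff (W j) q) / P.hx ^ 2 := by
  have he : P.dxx W j = fun k => (W (j - 1) k + W (j + 1) k - 2 * W j k) / P.hx ^ 2 :=
    funext fun k => P.dxx_apply W j k
  rw [he, sineCoeff_div_const, sineCoeff_sub, sineCoeff_add, sineCoeff_const_mul]

theorem sineCoeff_sN {W : ℕ → ℕ → ℂ} {j : ℕ} (hW0 : W j 0 = 0) (hWK : W j P.K = 0) (q : ℕ) :
    P.sineCoeff (P.sN W j) q = P.sig q * P.sineCoeff (W j) q +
      (P.sineCoeff (W (j - 1)) q + P.sineCoeff (W (j + 1)) q - 2 * P.sineCoeff (W j) q) / 12 := by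
  have h : (P.hx : ℂ) ≠ 0 := Complex.ofReal_ne_zero.2 P.hx_pos.ne'
  unfold sN
  rw [sineCoeff_add, sineCoeff_add, sineCoeff_const_mul, sineCoeff_const_mul,
    P.sineCoeff_dyy hW0 hWK, sineCoeff_dxx, sig]
  push_cast
  field_simp
  ring

theorem sineCoeff_lapN {W : ℕ → ℕ → ℂ} (hW0 : ∀ j, W j 0 = 0) (hWK : ∀ j, W j P.K = 0)
    (j q : ℕ) :
    P.sineCoeff (P.lapN W j) q = P.sig q *
      ((P.sineCoeff (W (j - 1)) q + P.sineCoeff (W (j + 1)) q - 2 * P.sineCoeff (W j) q) / P.hx ^ 2)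
      - P.lam q * (1 / 12 * P.sineCoeff (W (j - 1)) q + 5 / 6 * P.sineCoeff (W j) q +
        1 / 12 * P.sineCoeff (W (j + 1)) q) := by
  have hx0 : (P.hx : ℂ) ≠ 0 := Complex.ofReal_ne_zero.2 P.hx_pos.ne'
  have hy0 : (P.hy : ℂ) ≠ 0 := Complex.ofReal_ne_zero.2 P.hy_pos.ne'
  have h1 : P.sineCoeff (sNy (P.dxx W) j) q = P.sig q * P.sineCoeff (P.dxx W j) q := by
    have he : sNy (P.dxx W) j = fun k => 1 / 12 * (P.dxx W j (k - 1) + P.dxx W j (k + 1)) +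
        5 / 6 * P.dxx W j k := by
      funext k
      simp only [sNy, numerov]
      ring
    rw [he, sineCoeff_add, sineCoeff_const_mul, sineCoeff_const_mul,
      P.sineCoeff_second_diff (by simp [dxx_apply, hW0]) (by simp [dxx_apply, hWK]), sig]
    push_cast
    ring
  have h2 : P.sineCoeff (sNx (P.dyy W) j) q = 1 / 12 * P.sineCoeff (P.dyy W (j - 1)) q +
      5 / 6 * P.sineCoeff (P.dyy W j) q + 1 / 12 * P.sineCoeff (P.dyy W (j + 1)) q := by
    unfold sNx numerov
    rw [sineCoeff_add, sineCoeff_add, sineCoeff_const_mul, sineCoeff_const_mul,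
      sineCoeff_const_mul]
  unfold lapN
  rw [sineCoeff_add, h1, h2, sineCoeff_dxx, P.sineCoeff_dyy (hW0 _) (hWK _),
    P.sineCoeff_dyy (hW0 _) (hWK _), P.sineCoeff_dyy (hW0 _) (hWK _)]
  ring

/-! ### The solution near and beyond the artificial boundary -/

theorem X₀_le_node {j : ℕ} (hj : P.J ≤ j + 1) : P.X₀ ≤ j * P.hx := by
  have hJ : (0 : ℝ) < P.J := Nat.cast_pos.2 P.J_pos
  have h1 : (P.J : ℝ) * P.hx = P.X := by
    unfold hx
    field_simp
  have h2 : (P.J : ℝ) ≤ j + 1 := by exact_mod_cast hj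
  have h3 : P.hx ≤ P.X - P.X₀ := P.step_le
  nlinarith [P.hx_pos]

/-- For `J = 1` the assumption `h_x ≤ X - X₀` would give `X₀ ≤ 0`. Hence the column `J - 1` is
interior and the half steps hold on it. -/
theorem two_le_J : 2 ≤ P.J := by
  by_contra! h
  have := P.X₀_le_node (j := 0) (by omega)
  have := P.X₀_pos
  simp at *
  linarith

theorem VauxMesh_eq {j : ℕ} (hj : P.J ≤ j + 1) : P.VauxMesh j = P.Vinf :=
  P.Vaux_eq _ (P.X₀_le_node hj)

theorem deltaV_eq_zero {j k : ℕ} (hj : P.J ≤ j + 1) (hk : 1 ≤ k) (hkK : k ≤ P.K - 1) :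
    P.deltaV j k = 0 := by
  have hkK' : (k : ℝ) < P.K := by
    have := P.K_pos
    exact_mod_cast (by omega : k < P.K)
  have h1 : (P.K : ℝ) * P.hy = P.Y := by
    unfold hy
    have hK : (P.K : ℝ) ≠ 0 := Nat.cast_ne_zero.2 P.K_pos.ne'
    field_simp
  rw [deltaV, P.VauxMesh_eq hj, P.V_eq _ _ (P.X₀_le_node hj), sub_self]
  · exact mul_pos (by exact_mod_cast hk) P.hy_pos
  · rw [← h1]
    exact mul_lt_mul_of_pos_right hkK' P.hy_pos

variable {P} in
theorem PotentialStep.eq_of_deltaV_eq_zero {U U' : ℕ → ℕ → ℂ} {j k : ℕ}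
    (h : P.PotentialStep U U' j k) (h0 : P.deltaV j k = 0) : U' j k = U j k := by
  have h1 : (P.hbar : ℂ) ≠ 0 := Complex.ofReal_ne_zero.2 P.hbar_pos.ne'
  have h2 : (P.τ : ℂ) ≠ 0 := Complex.ofReal_ne_zero.2 P.τ_pos.ne'
  simpa [PotentialStep, h0, h1, h2, sub_eq_zero] using h

theorem omegaFin_union_gammaOne_subset : P.omegaFin ∪ P.gammaOne ⊆ P.omegaInf := by
  rintro p (hp | hp)
  · exact hp.1
  · exact ⟨hp.1 ▸ P.J_pos, hp.2⟩

theorem gammaFin_subset : P.gammaFin ⊆ P.gammaInf := by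
  rintro p ⟨⟨hp, hp'⟩, hp''⟩
  refine ⟨hp.1, fun h => ?_⟩
  have h1 : p.1 ≤ P.J := hp.2
  by_cases h2 : p.1 ≤ P.J - 1
  · exact hp' ⟨h, h2⟩
  · exact hp'' ⟨by omega, h.2⟩

variable {P}

theorem SolvesInf.solvesFin {Ψ0 : ℕ → ℕ → ℂ} {F Ψ Ψb Ψt : ℕ → ℕ → ℕ → ℂ}
    (h : P.SolvesInf Ψ0 F Ψ Ψb Ψt) : P.SolvesFin Ψ0 F Ψ Ψb Ψt where
  step1 m hm p hp := h.step1 m hm p (P.omegaFin_union_gammaOne_subset hp)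
  step2 m hm p hp := h.step2 m hm p hp.1
  step3 m hm p hp := h.step3 m hm p (P.omegaFin_union_gammaOne_subset hp)
  boundary m hm p hp := h.boundary m hm p (P.gammaFin_subset hp)
  initial p hp := h.initial p hp.1

theorem zero_mem_gammaInf (j : ℕ) : (j, 0) ∈ P.gammaInf :=
  ⟨Nat.zero_le _, fun h => absurd h.2.1 (by simp)⟩

theorem K_mem_gammaInf (j : ℕ) : (j, P.K) ∈ P.gammaInf :=
  ⟨le_refl P.K, fun h => by
    have h1 : P.K ≤ P.K - 1 := h.2.2
    have := P.K_pos
    omega⟩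

open Filter Topology in
theorem MemH.tendsto_sineCoeff {W : ℕ → ℕ → ℂ} (h : P.MemH W) (q : ℕ) :
    Tendsto (fun j => P.sineCoeff (W j) q) atTop (𝓝 0) := by
  have hk : ∀ k ∈ Finset.Icc 1 (P.K - 1), Tendsto (fun j => W j k) atTop (𝓝 0) := by
    intro k hk
    rw [← tendsto_add_atTop_iff_nat 1]
    have h1 : Tendsto (fun j => ‖W (j + 1) k‖ ^ 2) atTop (𝓝 0) :=
      squeeze_zero (fun j => by positivity)
        (fun j => Finset.single_le_sum (f := fun k => ‖W (j + 1) k‖ ^ 2)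
          (fun k _ => by positivity) hk) h.2.tendsto_atTop_zero
    have h2 := h1.sqrt
    simp only [Real.sqrt_sq (norm_nonneg _), Real.sqrt_zero] at h2
    exact tendsto_zero_iff_norm_tendsto_zero.2 h2
  unfold sineCoeff
  have := (tendsto_finsetSum _ fun k hk' => (hk k hk').mul_const
    (Real.sin (Real.pi * q * k / P.K) : ℂ)).const_mul (2 / P.K : ℂ)
  simpa using this

end StripProblem

/-! ### Generating functions in time and the boundary condition -/

namespace StripProblem

variable (P : StripProblem)

open PowerSeries in
theorem mk_kernel_sq (q : ℕ) : (PowerSeries.mk (P.kernel q)) ^ 2 =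
    C (P.c1 q ^ 2) * (1 - C (2 * (P.kappa q * P.mu q)) * PowerSeries.X +
      C (P.kappa q ^ 2) * PowerSeries.X ^ 2) := by
  refine sq_eq_quadratic_of_recurrence (f := P.kernel q) ?_ fun n => ?_
  · simp only [kernel]
    ring
  · have hn : ((n : ℂ) + 2) ≠ 0 := by exact_mod_cast (by omega : n + 2 ≠ 0)
    rw [kernel]
    push_cast
    field_simp
    ring

/-- The coefficient of the outer nodes in the normalized scheme for the `q`-th Fourier
coefficients: for the upper time level with `a` the conjugate of `a_q`, for the lower one with
`a = a_q`. -/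
noncomputable def outer (q : ℕ) (a : ℂ) : ℂ := 1 / 2 - P.theta q * P.hx ^ 2 * a

/-- Half the coefficient of the central node in the normalized scheme for the `q`-th Fourier
coefficients, with the same convention on `a` as in `outer`. -/
noncomputable def inner (q : ℕ) (a : ℂ) : ℂ := -1 / 2 - (1 / 2 - P.theta q) * P.hx ^ 2 * a

variable {P} {q : ℕ}

theorem sig_ne_zero (hq : 1 ≤ q) (hqK : q ≤ P.K - 1) : (P.sig q : ℂ) ≠ 0 :=
  Complex.ofReal_ne_zero.2 (by linarith [(P.sig_mem_Ioo hq hqK).1])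

/-- This is the coefficient of `∂_x ∂̄_x` once `λ s_{Nx}` is written as `λ / σ` times `σ + (h_x² /
12) ∂_x ∂̄_x` plus a remainder. The remainder accounts for the correction in `cHbarQ`, and the
factor `λ / σ` for the shift in `VinfQ`. -/
theorem cHbarQ_mul_sig (hq : 1 ≤ q) (hqK : q ≤ P.K - 1) : (P.cHbarQ q * P.sig q : ℂ) =
    P.cHbar * (P.sig q + P.hx ^ 2 * (P.lam q / P.sig q) * (1 - P.sig q) / 12) := by
  have hs := sig_ne_zero hq hqK
  have hl : (P.hy ^ 2 * P.lam q : ℂ) = 12 * (1 - P.sig q) := by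
    rw [sig]
    push_cast
    ring
  rw [cHbarQ]
  push_cast
  field_simp
  linear_combination P.cHbar * P.hx ^ 2 * P.lam q * hl

theorem theta_mul_sig (hq : 1 ≤ q) (hqK : q ≤ P.K - 1) : (P.theta q * P.sig q : ℂ) = 1 / 12 := by
  have hs := sig_ne_zero hq hqK
  rw [theta]
  push_cast
  field_simp

theorem cHbarQ_mul_sig_mul_outer (hq : 1 ≤ q) (hqK : q ≤ P.K - 1) (a : ℂ) :
    P.cHbarQ q * P.sig q * P.outer q a =
      P.cHbar * (P.sig q + P.hx ^ 2 * (P.lam q / P.sig q) * (1 - P.sig q) / 12) / 2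
        - P.hx ^ 2 / 12 * (P.cHbarQ q * a) := by
  rw [outer]
  linear_combination cHbarQ_mul_sig hq hqK / 2 -
    P.hx ^ 2 * P.cHbarQ q * a * theta_mul_sig hq hqK

theorem cHbarQ_mul_sig_mul_inner (hq : 1 ≤ q) (hqK : q ≤ P.K - 1) (a : ℂ) :
    P.cHbarQ q * P.sig q * P.inner q a =
      -P.cHbar * (P.sig q + P.hx ^ 2 * (P.lam q / P.sig q) * (1 - P.sig q) / 12) / 2
        - (P.sig q / 2 - 1 / 12) * P.hx ^ 2 * (P.cHbarQ q * a) := by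
  rw [inner]
  linear_combination -cHbarQ_mul_sig hq hqK / 2 +
    P.hx ^ 2 * P.cHbarQ q * a * theta_mul_sig hq hqK

/-- The hypothesis is the transformed main step with `F = 0`; it is multiplied by `h_x²` and divided
by `c_{ħ,q} σ_q`. The new level carries the conjugate of `a_q` because the time difference changes
sign between levels. -/
theorem normalized_scheme (hq : 1 ≤ q) (hqK : q ≤ P.K - 1) {t₀ t₁ t₂ b₀ b₁ b₂ : ℂ}
    (h : Complex.I * P.hbar * (P.sig q * ((t₁ - b₁) / P.τ) +
        ((t₀ - b₀) / P.τ + (t₂ - b₂) / P.τ - 2 * ((t₁ - b₁) / P.τ)) / 12) =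
      -P.cHbar * (P.sig q *
          (((t₀ + b₀) / 2 + (t₂ + b₂) / 2 - 2 * ((t₁ + b₁) / 2)) / P.hx ^ 2)
        - P.lam q * (1 / 12 * ((t₀ + b₀) / 2) + 5 / 6 * ((t₁ + b₁) / 2) +
          1 / 12 * ((t₂ + b₂) / 2))) +
      P.Vinf * (P.sig q * ((t₁ + b₁) / 2) +
        ((t₀ + b₀) / 2 + (t₂ + b₂) / 2 - 2 * ((t₁ + b₁) / 2)) / 12)) :
    P.outer q ((starRingEnd ℂ) (P.aQ q)) * (t₀ + t₂) +
      2 * P.inner q ((starRingEnd ℂ) (P.aQ q)) * t₁ +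
      P.outer q (P.aQ q) * (b₀ + b₂) + 2 * P.inner q (P.aQ q) * b₁ = 0 := by
  have hx0 : (P.hx : ℂ) ≠ 0 := Complex.ofReal_ne_zero.2 P.hx_pos.ne'
  have hh : (P.hx : ℂ) ^ 2 * ((P.hx : ℂ) ^ 2)⁻¹ = 1 := mul_inv_cancel₀ (pow_ne_zero 2 hx0)
  have hs := sig_ne_zero hq hqK
  have hss : (P.sig q : ℂ) * (P.sig q : ℂ)⁻¹ = 1 := mul_inv_cancel₀ hs
  have hc : (P.cHbarQ q : ℂ) ≠ 0 := Complex.ofReal_ne_zero.2 (P.cHbarQ_pos q).ne'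
  have o1 := cHbarQ_mul_sig_mul_outer hq hqK (P.aQ q)
  have o2 := cHbarQ_mul_sig_mul_outer hq hqK ((starRingEnd ℂ) (P.aQ q))
  have i1 := cHbarQ_mul_sig_mul_inner hq hqK (P.aQ q)
  have i2 := cHbarQ_mul_sig_mul_inner hq hqK ((starRingEnd ℂ) (P.aQ q))
  rw [cHbarQ_mul_aQ, VinfQ] at o1 i1
  rw [cHbarQ_mul_conj_aQ, VinfQ] at o2 i2
  push_cast at o1 o2 i1 i2
  apply mul_left_cancel₀ (mul_ne_zero hc hs)
  linear_combination (t₀ + t₂) * o2 + 2 * t₁ * i2 + (b₀ + b₂) * o1 + 2 * b₁ * i1 + P.hx ^ 2 * h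
    - P.sig q * P.cHbar * ((t₀ + t₂ + b₀ + b₂) / 2 - (t₁ + b₁)) * hh
    - P.cHbar * P.lam q * P.hx ^ 2 * ((t₀ + t₂ + b₀ + b₂) / 24 + 5 * (t₁ + b₁) / 12) * hss

theorem SolvesInf.breve_eq {Ψ0 : ℕ → ℕ → ℂ} {F Ψ Ψb Ψt : ℕ → ℕ → ℕ → ℂ}
    (h : P.SolvesInf Ψ0 F Ψ Ψb Ψt) {m j : ℕ} (hm : 1 ≤ m) (hj : P.J ≤ j + 1) (q : ℕ) :
    P.sineCoeff (Ψb m j) q = P.sineCoeff (Ψ (m - 1) j) q :=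
  P.sineCoeff_congr q fun k hk hkK => by
    have := P.two_le_J
    exact (h.step1 m hm (j, k) ⟨by simp only; omega, hk, hkK⟩).eq_of_deltaV_eq_zero
      (P.deltaV_eq_zero hj hk hkK)

theorem SolvesInf.tilde_eq {Ψ0 : ℕ → ℕ → ℂ} {F Ψ Ψb Ψt : ℕ → ℕ → ℕ → ℂ}
    (h : P.SolvesInf Ψ0 F Ψ Ψb Ψt) {m j : ℕ} (hm : 1 ≤ m) (hj : P.J ≤ j + 1) (q : ℕ) :
    P.sineCoeff (Ψt m j) q = P.sineCoeff (Ψ m j) q :=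
  P.sineCoeff_congr q fun k hk hkK => by
    have := P.two_le_J
    exact ((h.step3 m hm (j, k) ⟨by simp only; omega, hk, hkK⟩).eq_of_deltaV_eq_zero
      (P.deltaV_eq_zero hj hk hkK)).symm

theorem SolvesInf.sineCoeff_scheme {Ψ0 : ℕ → ℕ → ℂ} {F Ψ Ψb Ψt : ℕ → ℕ → ℕ → ℂ}
    (h : P.SolvesInf Ψ0 F Ψ Ψb Ψt)
    (hF : ∀ m ≥ 1, ∀ p ∈ P.omegaInf \ P.omegaFin, F m p.1 p.2 = 0)
    {m j : ℕ} (hm : 1 ≤ m) (hj : P.J ≤ j + 1) (hq : 1 ≤ q) (hqK : q ≤ P.K - 1) :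
    P.outer q ((starRingEnd ℂ) (P.aQ q)) *
        (P.sineCoeff (Ψ m j) q + P.sineCoeff (Ψ m (j + 2)) q) +
      2 * P.inner q ((starRingEnd ℂ) (P.aQ q)) * P.sineCoeff (Ψ m (j + 1)) q +
      P.outer q (P.aQ q) *
        (P.sineCoeff (Ψ (m - 1) j) q + P.sineCoeff (Ψ (m - 1) (j + 2)) q) +
      2 * P.inner q (P.aQ q) * P.sineCoeff (Ψ (m - 1) (j + 1)) q = 0 := by
  rw [← h.tilde_eq hm hj, ← h.tilde_eq hm (by omega : P.J ≤ j + 1 + 1),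
    ← h.tilde_eq hm (by omega : P.J ≤ j + 2 + 1), ← h.breve_eq hm hj,
    ← h.breve_eq hm (by omega : P.J ≤ j + 1 + 1), ← h.breve_eq hm (by omega : P.J ≤ j + 2 + 1)]
  apply normalized_scheme hq hqK
  have hz : ∀ i, Ψb m i 0 = 0 ∧ Ψt m i 0 = 0 := fun i =>
    ⟨(h.boundary m hm _ (zero_mem_gammaInf i)).1, (h.boundary m hm _ (zero_mem_gammaInf i)).2.1⟩
  have hzK : ∀ i, Ψb m i P.K = 0 ∧ Ψt m i P.K = 0 := fun i =>
    ⟨(h.boundary m hm _ (K_mem_gammaInf i)).1, (h.boundary m hm _ (K_mem_gammaInf i)).2.1⟩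
  have key := P.sineCoeff_congr q fun k hk hkK => by
    have := P.two_le_J
    have hF0 : F m (j + 1) k = 0 := hF m hm (j + 1, k) ⟨⟨by simp, hk, hkK⟩, fun hmem => by
      have : j + 1 ≤ P.J - 1 := hmem.2
      omega⟩
    have h2 := h.step2 m hm (j + 1, k) ⟨by simp, hk, hkK⟩
    simp only [MainStep, hF0, add_zero] at h2
    exact h2
  rw [sineCoeff_const_mul, sineCoeff_add, sineCoeff_const_mul,
    P.sineCoeff_sN (by simp [hz]) (by simp [hzK]), P.sineCoeff_sN (by simp [hz]) (by simp [hzK]),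
    P.sineCoeff_lapN (by simp [hz]) (by simp [hzK])] at key
  simp only [sineCoeff_const_mul, sineCoeff_div_const, sineCoeff_sub, sineCoeff_add,
    Nat.add_sub_cancel, P.VauxMesh_eq hj, P.VauxMesh_eq (by omega : P.J ≤ j + 1 + 1),
    P.VauxMesh_eq (by omega : P.J ≤ j + 1 + 1 + 1)] at key
  linear_combination key

theorem beta_eq_add_conj (q : ℕ) : (P.beta q : ℂ) = P.aQ q + (starRingEnd ℂ) (P.aQ q) +
    (1 - 4 * P.theta q) * P.hx ^ 2 * (P.aQ q * (starRingEnd ℂ) (P.aQ q)) := by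
  rw [Complex.add_conj, Complex.mul_conj, beta, Complex.sq_norm]
  push_cast
  ring

/-- The numbers `inner ± h_x c1` have product `outer²`, so it is enough that the one with the plus
sign is the larger. This follows from the nonnegative real part of `inner` times the conjugate of
`c1`. -/
theorem norm_outer_le (hq : 1 ≤ q) (hqK : q ≤ P.K - 1) :
    ‖P.outer q ((starRingEnd ℂ) (P.aQ q))‖ ≤
      ‖P.inner q ((starRingEnd ℂ) (P.aQ q)) + P.hx * P.c1 q‖ := by
  set a := (starRingEnd ℂ) (P.aQ q) with ha
  have hprod : (P.inner q a + P.hx * P.c1 q) * (P.inner q a - P.hx * P.c1 q) =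
      P.outer q a ^ 2 := by
    have h1 := P.c1_sq q
    simp only [alpha, map_add, map_mul, map_sub, map_pow, map_one, map_ofNat,
      Complex.conj_ofReal, ← ha] at h1
    simp only [inner, outer]
    linear_combination -P.hx ^ 2 * h1
  have hre : 0 ≤ (P.inner q a * (starRingEnd ℂ) (P.hx * P.c1 q)).re := by
    have hth := (P.theta_mem_Ioo hq hqK).2
    have h1 := P.re_mul_conj_c1_nonneg hq hqK (t := (1 - 2 * P.theta q) * P.hx ^ 2) (by
      unfold delta
      nlinarith [pow_pos P.hx_pos 2])
    have h2 : P.inner q a * (starRingEnd ℂ) (P.hx * P.c1 q) = ((P.hx / 2 : ℝ) : ℂ) *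
        (-(1 + ((1 - 2 * P.theta q) * P.hx ^ 2 : ℝ) * a) * (starRingEnd ℂ) (P.c1 q)) := by
      rw [inner, map_mul, Complex.conj_ofReal]
      push_cast
      ring
    rw [h2, Complex.re_ofReal_mul]
    exact mul_nonneg (by linarith [P.hx_pos]) h1
  have hle : ‖P.inner q a - P.hx * P.c1 q‖ ≤ ‖P.inner q a + P.hx * P.c1 q‖ := by
    rw [← sq_le_sq₀ (norm_nonneg _) (norm_nonneg _), Complex.sq_norm, Complex.sq_norm,
      Complex.normSq_sub, Complex.normSq_add]
    linarith
  rw [← sq_le_sq₀ (norm_nonneg _) (norm_nonneg _), ← norm_pow, ← hprod, norm_mul, sq]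
  gcongr

-- Both sides are quadratic in `X`. Their coefficients agree because `inner² - outer²` equals `h_x²
-- α / 4` at `a_q`, its conjugate at the conjugate of `a_q`, and the mixed term is `h_x² β / 4`.
open PowerSeries in
theorem sq_hx_mul_kernel (hq : 1 ≤ q) (hqK : q ≤ P.K - 1) :
    (C (P.hx : ℂ) * PowerSeries.mk (P.kernel q)) ^ 2 =
      (C (P.inner q ((starRingEnd ℂ) (P.aQ q))) + C (P.inner q (P.aQ q)) * PowerSeries.X) ^ 2 -
      (C (P.outer q ((starRingEnd ℂ) (P.aQ q))) + C (P.outer q (P.aQ q)) * PowerSeries.X) ^ 2 := by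
  have hα : (starRingEnd ℂ) (P.alpha q) = 2 * (starRingEnd ℂ) (P.aQ q) +
      (1 - 4 * P.theta q) * P.hx ^ 2 * (starRingEnd ℂ) (P.aQ q) ^ 2 := by
    simp only [alpha, map_add, map_mul, map_sub, map_pow, map_one, map_ofNat, Complex.conj_ofReal]
  have h1 := P.c1_sq q
  have h2 := P.c1_sq_mul_kappa_mul_mu hq hqK
  have h3 := P.c1_sq_mul_kappa_sq q
  have hβ := beta_eq_add_conj (P := P) q
  have e0 : P.hx ^ 2 * P.c1 q ^ 2 = P.inner q ((starRingEnd ℂ) (P.aQ q)) ^ 2 -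
      P.outer q ((starRingEnd ℂ) (P.aQ q)) ^ 2 := by
    rw [h1, hα, inner, outer]
    ring
  have e1 : -(2 * (P.hx ^ 2 * (P.c1 q ^ 2 * (P.kappa q * P.mu q)))) =
      2 * (P.inner q ((starRingEnd ℂ) (P.aQ q)) * P.inner q (P.aQ q) -
      P.outer q ((starRingEnd ℂ) (P.aQ q)) * P.outer q (P.aQ q)) := by
    rw [h2, hβ, inner, outer, inner, outer]
    ring
  have e2 : P.hx ^ 2 * (P.c1 q ^ 2 * P.kappa q ^ 2) = P.inner q (P.aQ q) ^ 2 -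
      P.outer q (P.aQ q) ^ 2 := by
    rw [h3, alpha, inner, outer]
    ring
  replace e0 := congrArg (C : ℂ →+* PowerSeries ℂ) e0
  replace e1 := congrArg (C : ℂ →+* PowerSeries ℂ) e1
  replace e2 := congrArg (C : ℂ →+* PowerSeries ℂ) e2
  rw [mul_pow, mk_kernel_sq]
  simp only [map_sub, map_neg, map_mul, map_pow, map_ofNat] at e0 e1 e2 ⊢
  linear_combination e0 + PowerSeries.X * e1 + PowerSeries.X ^ 2 * e2

theorem outer_ne_zero (hq : 1 ≤ q) (hqK : q ≤ P.K - 1) :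
    P.outer q ((starRingEnd ℂ) (P.aQ q)) ≠ 0 := by
  intro h
  have h1 := congrArg Complex.im h
  have h2 : 0 < P.theta q * P.hx ^ 2 * (P.aQ q).im :=
    mul_pos (mul_pos (by linarith [(P.theta_mem_Ioo hq hqK).1]) (pow_pos P.hx_pos 2))
      (P.aQ_im_pos q)
  rw [outer, ← Complex.ofReal_pow, ← Complex.ofReal_mul, Complex.sub_im, Complex.im_ofReal_mul,
    Complex.conj_im] at h1
  norm_num at h1
  rcases h1 with (h1 | h1) | h1 <;> simp [h1] at h2

open PowerSeries in
theorem SolvesInf.tbc {Ψ0 : ℕ → ℕ → ℂ} {F Ψ Ψb Ψt : ℕ → ℕ → ℕ → ℂ}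
    (h : P.SolvesInf Ψ0 F Ψ Ψb Ψt) (hH : ∀ m, P.MemH (Ψ m))
    (hΨ0 : ∀ p ∈ P.omegaInf \ P.omegaFin, Ψ0 p.1 p.2 = 0)
    (hF : ∀ m ≥ 1, ∀ p ∈ P.omegaInf \ P.omegaFin, F m p.1 p.2 = 0)
    (hΨ0J : ∀ k ≤ P.K, Ψ0 (P.J - 1) k = 0)
    {m : ℕ} (hm : 1 ≤ m) (hq : 1 ≤ q) (hqK : q ≤ P.K - 1) : P.TBC Ψ Ψb Ψt q m := by
  have hJ := P.two_le_J
  -- The column `J - 1` lies in the finite interior mesh and needs its own assumption on `Ψ0`;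
  -- beyond it, the support condition applies.
  have hzero : ∀ j, P.J ≤ j + 1 → P.sineCoeff (Ψ 0 j) q = 0 := by
    intro j hj
    have : P.sineCoeff (Ψ 0 j) q = P.sineCoeff (fun k => 0 * Ψ 0 j k) q := by
      refine P.sineCoeff_congr q fun k hk hkK => ?_
      rw [h.initial (j, k) (show k ≤ P.K by omega), zero_mul]
      rcases Nat.eq_or_lt_of_le hj with hj' | hj'
      · rw [show (j, k).1 = P.J - 1 by simp only; omega]
        exact hΨ0J k (by omega)
      · refine hΨ0 (j, k) ⟨⟨by simp only; omega, hk, hkK⟩, fun hmem => ?_⟩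
        have : j ≤ P.J - 1 := hmem.2
        omega
    rw [this, sineCoeff_const_mul, zero_mul]
  set a := P.aQ q with ha
  set ac := (starRingEnd ℂ) a with hac
  set A : PowerSeries ℂ := C (P.outer q ac) + C (P.outer q a) * PowerSeries.X with hA
  set B : PowerSeries ℂ := C (P.inner q ac) + C (P.inner q a) * PowerSeries.X with hB
  set S : PowerSeries ℂ := C (P.hx : ℂ) * PowerSeries.mk (P.kernel q) with hS
  set U : ℕ → PowerSeries ℂ := fun i =>
    PowerSeries.mk fun m => P.sineCoeff (Ψ m (P.J - 1 + i)) q with hU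
  have hcA : constantCoeff A = P.outer q ac := by simp [hA]
  have hcBS : constantCoeff (B + S) = P.inner q ac + P.hx * P.c1 q := by
    simp [hB, hS, ← coeff_zero_eq_constantCoeff_apply, -coeff_zero_eq_constantCoeff, kernel]
  have hmain : (B + S) * U 1 + A * U 0 = 0 := by
    refine decaying_solution_of_three_term ?_ ?_ (sq_hx_mul_kernel hq hqK) ?_ ?_
    · rw [hcA]
      exact outer_ne_zero hq hqK
    · rw [hcA, hcBS]
      exact norm_outer_le hq hqK
    · intro j
      have e : A * U (j + 2) + 2 * B * U (j + 1) + A * U j =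
          C (P.outer q ac) * (U j + U (j + 2)) + C (2 * P.inner q ac) * U (j + 1) +
          (C (P.outer q a) * (PowerSeries.X * (U j + U (j + 2))) +
            C (2 * P.inner q a) * (PowerSeries.X * U (j + 1))) := by
        simp only [hA, hB, map_mul, map_ofNat]
        ring
      rw [e]
      ext n
      -- Degree `0` involves only the vanishing initial data; degree `n + 1` is the scheme from
      -- level `n` to level `n + 1`.
      rcases n with _ | n
      · simp only [map_add, coeff_C_mul, coeff_zero_X_mul, hU, coeff_mk,
          hzero (P.J - 1 + j) (by omega), hzero (P.J - 1 + (j + 1)) (by omega),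
          hzero (P.J - 1 + (j + 2)) (by omega)]
        simp
      · have := h.sineCoeff_scheme hF (m := n + 1) (j := P.J - 1 + j) (by omega) (by omega) hq hqK
        simp only [map_add, coeff_C_mul, coeff_succ_X_mul, hU, coeff_mk, map_zero]
        simp only [Nat.add_sub_cancel] at this
        linear_combination this
    · intro m
      simp only [hU, coeff_mk]
      refine (hH m).tendsto_sineCoeff q |>.comp (Filter.tendsto_atTop_mono (fun j => ?_)
        Filter.tendsto_id)
      exact Nat.le_add_left _ _
  obtain ⟨n, rfl⟩ : ∃ n, m = n + 1 := ⟨m - 1, by omega⟩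
  have e : (B + S) * U 1 + A * U 0 =
      C (P.inner q ac) * U 1 + C (P.inner q a) * (PowerSeries.X * U 1) +
      C (P.hx : ℂ) * (PowerSeries.mk (P.kernel q) * U 1) + C (P.outer q ac) * U 0 +
      C (P.outer q a) * (PowerSeries.X * U 0) := by
    simp only [hA, hB, hS]
    ring
  rw [e] at hmain
  -- The coefficient at the time level `m = n + 1`: the product with the kernel becomes the
  -- convolution, the terms of `A` and `B` the left side of the condition.
  have hco := congrArg (coeff (n + 1)) hmain
  have hconv : coeff (n + 1) (PowerSeries.mk (P.kernel q) * U 1) = conv (P.kernel q)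
      (fun n => P.sineCoeff (if n = 0 then Ψ 0 P.J else Ψt n P.J) q) (n + 1) := by
    rw [coeff_mul, Finset.Nat.sum_antidiagonal_eq_sum_range_succ_mk, conv]
    refine Finset.sum_congr rfl fun p _ => ?_
    simp only [hU, coeff_mk, Nat.sub_add_cancel P.J_pos]
    split_ifs with h0
    · rw [h0]
    · rw [h.tilde_eq (by omega) (by omega)]
  simp only [map_add, coeff_C_mul, coeff_succ_X_mul, hconv, map_zero] at hco
  simp only [hU, coeff_mk, Nat.sub_add_cancel P.J_pos, add_zero] at hco
  have hx0 : (P.hx : ℂ) ≠ 0 := Complex.ofReal_ne_zero.2 P.hx_pos.ne'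
  have hca := P.cHbarQ_mul_aQ q
  have hcac := P.cHbarQ_mul_conj_aQ q
  rw [← ha] at hca
  rw [← ha, ← hac] at hcac
  unfold TBC bdiff sMinus
  simp only [h.tilde_eq hm (by omega : P.J ≤ P.J + 1), h.breve_eq hm (by omega : P.J ≤ P.J + 1),
    h.tilde_eq hm (by omega : P.J ≤ P.J - 1 + 1), h.breve_eq hm (by omega : P.J ≤ P.J - 1 + 1),
    Nat.add_sub_cancel]
  generalize conv (P.kernel q) (fun n => P.sineCoeff (if n = 0 then Ψ 0 P.J else Ψt n P.J) q)
    (n + 1) = R at hco ⊢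
  generalize P.sineCoeff (Ψ (n + 1) P.J) q = u₁ at hco ⊢
  generalize P.sineCoeff (Ψ n P.J) q = v₁ at hco ⊢
  generalize P.sineCoeff (Ψ (n + 1) (P.J - 1)) q = u₀ at hco ⊢
  generalize P.sineCoeff (Ψ n (P.J - 1)) q = v₀ at hco ⊢
  simp only [inner, outer] at hco
  apply mul_left_cancel₀ hx0
  have hdiv : (P.hx : ℂ) * (P.hx : ℂ)⁻¹ = 1 := mul_inv_cancel₀ hx0
  linear_combination -P.cHbarQ q * hco + P.cHbarQ q * ((u₁ + v₁) / 2 - (u₀ + v₀) / 2) * hdiv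
    - P.hx ^ 2 * ((1 / 2 - P.theta q) * v₁ + P.theta q * v₀) * hca
    - P.hx ^ 2 * ((1 / 2 - P.theta q) * u₁ + P.theta q * u₀) * hcac

end StripProblem

theorem mainTheorem3 (P : StripProblem)
    (Ψ0 : ℕ → ℕ → ℂ) (F : ℕ → ℕ → ℕ → ℂ)
    (hΨ0 : ∀ p ∈ P.omegaInf \ P.omegaFin, Ψ0 p.1 p.2 = 0)
    (hF : ∀ m ≥ 1, ∀ p ∈ P.omegaInf \ P.omegaFin, F m p.1 p.2 = 0)
    (hΨ0J : ∀ k ≤ P.K, Ψ0 (P.J - 1) k = 0) :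
    (∀ q : ℕ, 1 ≤ q → q ≤ P.K - 1 →
      P.theta q ∈ Set.Ioo (1 / 12 : ℝ) (1 / 8) ∧
      P.alpha q ≠ 0 ∧
      StripProblem.argTwoPi (P.alpha q) ∈ Set.Ioo 0 (2 * Real.pi) ∧
      P.mu q ∈ Set.Ioo (-1 : ℝ) 1) ∧
    ∀ Ψ Ψb Ψt : ℕ → ℕ → ℕ → ℂ,
      P.SolvesInf Ψ0 F Ψ Ψb Ψt → (∀ m, P.MemH (Ψ m)) →
        P.SolvesFin Ψ0 F Ψ Ψb Ψt ∧
        ∀ m q : ℕ, 1 ≤ m → 1 ≤ q → q ≤ P.K - 1 → P.TBC Ψ Ψb Ψt q m :=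
  ⟨fun _ hq hqK => ⟨P.theta_mem_Ioo hq hqK, P.alpha_ne_zero hq hqK,
    StripProblem.argTwoPi_mem_Ioo (P.arg_alpha_ne_zero hq hqK), P.mu_mem_Ioo hq hqK⟩,
    fun _ _ _ h hH => ⟨h.solvesFin, fun _ _ hm hq hqK => h.tbc hH hΨ0 hF hΨ0J hm hq hqK⟩⟩
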